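/- Let $(\Omega,d)$ be a Hadamard space with its Borel $\sigma$-algebra, i.e. a complete metric space such that for all $x,y\in\Omega$ there is $m\in\Omega$ with $d(z,m)^2\le\frac12 d(z,x)^2+\frac12 d(z,y)^2-\frac14 d(x,y)^2$ for every $z\in\Omega$; let $\gamma_x^y:[0,1]\to\Omega$ be the unique constant-speed geodesic from $x$ to $y$. The Fréchet mean of a random variable $X$ in $L^1(\Omega)$ (that is, $E\,d(X,z)<\infty$ for some $z$) is the minimizer of $w\mapsto E[d(X,w)^2-d(X,z)^2]$, which does not depend on $z$. Let $(\varepsilon_t)_{t\in\mathbb N}$ be i.i.d. random maps $\Omega\to\Omega$ that are unbiased: for every $x\in\Omega$, $\varepsilon_t(x)$ is in $L^1(\Omega)$ and has Fréchet mean $x$. Let $(X_t)_{t\in\mathbb N}$, with $\mathbb N=\{0,1,2,\dots\}$, be random variables in $L^1(\Omega)$ with common Fréchet mean $\mu$ that follow the geodesic autoregressive model with concentration parameter $\varphi\in[0,1]$: almost surely, $X_{t+1}=\varepsilon_{t+1}(\gamma_\mu^{X_t}(\varphi))$ for all $t\in\mathbb N$. Assume $H_0:\varphi=0$. Assume that $d$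 is measurable for the product $\sigma$-algebra on $\Omega\times\Omega$, up to a null set of the law of $(X_1,X_2)$ (this is automatic if $\Omega$ is separable), and that $d(X_1,X_2)^2$ has finite variance, i.e. $E\,d(X_1,X_2)^4<\infty$. Then $X_1,X_2,\dots$ are i.i.d. copies of $\varepsilon_t(\mu)$; the number $$\sigma_0^2=\mathrm{Var}\big(d(X_1,X_2)^2\big)+2\,\mathrm{Cov}\big(d(X_1,X_2)^2,d(X_1,X_3)^2\big)$$ is nonnegative; and the serial statistic $D_T=\frac1{T-1}\sum_{t=1}^{T-1}d(X_t,X_{t+1})^2$ satisfies, as $T\to\infty$, $$\sqrt T\,\big(D_T-E\,d(X_1,X_2)^2\big)\longrightarrow N(0,\sigma_0^2)\quad\text{in distribution},$$ where $N(0,0)$ is the point mass at $0$. -/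

import Mathlib

open MeasureTheory ProbabilityTheory Filter

/-- A Hadamard space: a complete metric space satisfying the non-positive curvature inequality
at a midpoint of every pair of points. -/
structure IsHadamard (Ω : Type*) [MetricSpace Ω] : Prop where
  complete : CompleteSpace Ω
  npc : ∀ x y : Ω, ∃ m : Ω, ∀ z : Ω,
    dist z m ^ 2 ≤ (1 / 2) * dist z x ^ 2 + (1 / 2) * dist z y ^ 2 - (1 / 4) * dist x y ^ 2

/-- `γ : [0,1] → Ω` is the geodesic from `x` to `y`, parametrised proportionally to arc length.
In a Hadamard space it exists and is unique. -/
structure IsGeodesic {Ω : Type*} [MetricSpace Ω] (γ : unitInterval → Ω) (x y : Ω) : Prop where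
  source : γ 0 = x
  target : γ 1 = y
  dist_eq : ∀ s t : unitInterval, dist (γ s) (γ t) = |(s : ℝ) - t| * dist x y

/-- `X` is a Borel random variable in `L¹(Ω)`: `E d(X, z) < ∞` for some (equivalently, all) `z`. -/
structure InL1 {S Ω : Type*} [MeasurableSpace S] [MetricSpace Ω] [MeasurableSpace Ω]
    (P : Measure S) (X : S → Ω) : Prop where
  measurable : Measurable X
  integrable : ∃ z : Ω, Integrable (fun s => dist (X s) z) P

/-- `m` is the Fréchet mean of `X`: it minimises `w ↦ E[d(X, w)² - d(X, z)²]`, for every choice of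
the reference point `z`. For `X` in `L¹(Ω)` the integrand is integrable, and in a Hadamard space
the minimiser exists and is unique. -/
def IsFrechetMean {S Ω : Type*} [MeasurableSpace S] [MetricSpace Ω]
    (P : Measure S) (X : S → Ω) (m : Ω) : Prop :=
  ∀ z : Ω, IsMinOn (fun w => ∫ s, (dist (X s) w ^ 2 - dist (X s) z ^ 2) ∂P) Set.univ m

/-- `ε 0, ε 1, …` are i.i.d. unbiased noise maps: random maps `Ω → Ω` (random elements of `Ω → Ω`
with the σ-algebra generated by the evaluations), independent, identically distributed, such that
`ε t x` is in `L¹(Ω)` and has Fréchet mean `x`, for every `x`. -/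
structure IsIIDUnbiasedNoise {S Ω : Type*} [MeasurableSpace S] [MetricSpace Ω] [MeasurableSpace Ω]
    (P : Measure S) (ε : ℕ → S → Ω → Ω) : Prop where
  indep : iIndepFun ε P
  identDistrib : ∀ t : ℕ, IdentDistrib (ε t) (ε 0) P P
  inL1 : ∀ (t : ℕ) (x : Ω), InL1 P (fun s => ε t s x)
  unbiased : ∀ (t : ℕ) (x : Ω), IsFrechetMean P (fun s => ε t s x) x

/-- The geodesic autoregressive model GAR(1) with mean `μ`, concentration parameter `φ ∈ [0,1]` and
noise maps `ε`: the `X t` are in `L¹(Ω)` with common Fréchet mean `μ`, and almost surely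
`X (t+1) = ε (t+1) (γ φ)`, with `γ` the geodesic from `μ` to `X t`. -/
structure IsGAR1 {S Ω : Type*} [MeasurableSpace S] [MetricSpace Ω] [MeasurableSpace Ω]
    (P : Measure S) (ε : ℕ → S → Ω → Ω) (X : ℕ → S → Ω) (μ : Ω) (φ : unitInterval) : Prop where
  noise : IsIIDUnbiasedNoise P ε
  inL1 : ∀ t : ℕ, InL1 P (X t)
  mean : ∀ t : ℕ, IsFrechetMean P (X t) μ
  recursion : ∀ t : ℕ, ∀ᵐ s ∂P, ∃ γ : unitInterval → Ω,
    IsGeodesic γ μ (X t s) ∧ X (t + 1) s = ε (t + 1) s (γ φ)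

/-- The serial statistic `D_T = (T - 1)⁻¹ ∑_{t=1}^{T-1} d(X_t, X_{t+1})²`. -/
noncomputable def serialStat {S Ω : Type*} [MetricSpace Ω] (X : ℕ → S → Ω) (T : ℕ) (s : S) : ℝ :=
  (1 / ((T : ℝ) - 1)) * ∑ t ∈ Finset.Ico 1 T, dist (X t s) (X (t + 1) s) ^ 2

/-- `σ₀² = Var d(X₁, X₂)² + 2 Cov(d(X₁, X₂)², d(X₁, X₃)²)`. -/
noncomputable def nullVariance {S Ω : Type*} [MeasurableSpace S] [MetricSpace Ω]
    (P : Measure S) (X : ℕ → S → Ω) : ℝ :=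
  variance (fun s => dist (X 1 s) (X 2 s) ^ 2) P +
    2 * covariance (fun s => dist (X 1 s) (X 2 s) ^ 2) (fun s => dist (X 1 s) (X 3 s) ^ 2) P

/-! At `φ = 0` the geodesic is evaluated at its source `μ`, so `X (t + 1)` is a.s. `ε (t + 1) μ` and
the sequence from time 1 on is i.i.d. Consecutive squared distances share at most one variable,
hence form a stationary one-dependent sequence. The theorem is the CLT for such sequences,
`tendstoInDistribution_of_oneDependent`, followed by Slutsky.

That CLT uses big blocks with gaps: drop every `(m + 2)`-th term, so that the sums over the
remaining blocks of length `m + 1` are i.i.d. and obey the classical CLT. The dropped terms have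
variance of order `n / m`, which after division by `√n` moves characteristic functions by `O(m ^
(-1/2))` uniformly in large `n`. Letting `n → ∞`, then `m → ∞`, gives the variance `v + 2 * c`. -/

/-! ### Variance bounds, block decomposition and the i.i.d. ingredient. -/

section OneDependent

variable {S : Type*} [MeasurableSpace S] {P : Measure S} {W : ℕ → S → ℝ} {v c : ℝ}

/-- The variance of the sum of the first `m + 1` terms of a sequence with variances `v`,
consecutive covariances `c`, and vanishing covariances at larger lags. -/
lemma variance_sum_range_of_oneDependent [IsProbabilityMeasure P]
    (hL : ∀ k, MemLp (W k) 2 P) (hv : ∀ k, Var[W k; P] = v)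
    (hc : ∀ k, cov[W k, W (k + 1); P] = c)
    (hz : ∀ i j, i + 1 < j → cov[W i, W j; P] = 0) (m : ℕ) :
    Var[fun ω => ∑ i ∈ Finset.range (m + 1), W i ω; P] = (m + 1) * v + 2 * m * c := by
  induction m with
  | zero => simp [hv]
  | succ m ih =>
    have h1 : (fun ω => ∑ i ∈ Finset.range (m + 1 + 1), W i ω)
        = fun ω => (∑ i ∈ Finset.range (m + 1), W i ω) + W (m + 1) ω := by
      ext ω; rw [Finset.sum_range_succ]
    rw [h1, variance_fun_add (memLp_finsetSum _ fun i _ => hL i) (hL _), ih, hv,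
      covariance_fun_sum_left' (fun i _ => hL i) (hL _), Finset.sum_range_succ, hc,
      Finset.sum_eq_zero (fun i hi => hz i _ (by have := Finset.mem_range.1 hi; omega))]
    push_cast
    ring

/-- The variance of a sum over a finite index set grows at most linearly in the number of terms,
for a sequence as in `variance_sum_range_of_oneDependent`. -/
lemma variance_sum_le_of_oneDependent [IsProbabilityMeasure P]
    (hL : ∀ k, MemLp (W k) 2 P) (hv : ∀ k, Var[W k; P] = v)
    (hc : ∀ k, cov[W k, W (k + 1); P] = c)
    (hz : ∀ i j, i + 1 < j → cov[W i, W j; P] = 0) (A : Finset ℕ) :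
    Var[fun ω => ∑ i ∈ A, W i ω; P] ≤ A.card * (v + 2 * |c|) := by
  have hv0 : 0 ≤ v := hv 0 ▸ variance_nonneg _ _
  rw [variance_fun_sum' (fun i _ => hL i), ← nsmul_eq_mul]
  refine Finset.sum_le_card_nsmul _ _ _ fun i _ => ?_
  -- A row of the covariance matrix has `v` on the diagonal and `c` beside it. For `i = 0` the
  -- truncated `i - 1` only adds a spare `|c|`.
  have key : ∀ j, cov[W i, W j; P] ≤
      (if j = i then v else 0) + (if j = i + 1 then |c| else 0)
        + (if j = i - 1 then |c| else 0) := by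
    intro j
    have hc0 := abs_nonneg c
    have hc1 := le_abs_self c
    rcases lt_trichotomy j i with h | rfl | h
    · rw [covariance_comm]
      rcases Nat.lt_or_ge (j + 1) i with h' | h'
      · rw [hz j i h']; split_ifs <;> linarith
      · obtain rfl : i = j + 1 := by omega
        rw [hc, if_neg (by omega), if_neg (by omega), if_pos (by omega)]; linarith
    · rw [covariance_self (hL j).aemeasurable, hv, if_pos rfl]
      split_ifs <;> linarith
    · rcases Nat.lt_or_ge (i + 1) j with h' | h'
      · rw [hz i j h']; split_ifs <;> linarith
      · obtain rfl : j = i + 1 := by omega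
        rw [hc, if_neg (by omega), if_pos rfl]
        split_ifs <;> linarith
  refine (Finset.sum_le_sum fun j _ => key j).trans ?_
  rw [Finset.sum_add_distrib, Finset.sum_add_distrib]
  simp only [Finset.sum_ite_eq']
  have hc0 := abs_nonneg c
  split_ifs <;> linarith

/-- Characteristic functions are Lipschitz with respect to the `L²` distance of the variables. -/
lemma norm_charFun_map_sub_le [IsProbabilityMeasure P] {U V : S → ℝ} (hU : MemLp U 2 P)
    (hV : MemLp V 2 P) (t : ℝ) :
    ‖charFun (P.map U) t - charFun (P.map V) t‖ ≤ |t| * √(∫ ω, (U ω - V ω) ^ 2 ∂P) := by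
  have hD : MemLp (fun ω => U ω - V ω) 2 P := hU.sub hV
  have hUm := hU.aemeasurable
  have hVm := hV.aemeasurable
  have hint : ∀ {Z : S → ℝ}, AEMeasurable Z P →
      Integrable (fun ω => Complex.exp (t * Z ω * Complex.I)) P := by
    intro Z hZ
    refine Integrable.of_bound (by fun_prop) 1 (.of_forall fun ω => ?_)
    rw [← Complex.ofReal_mul, Complex.norm_exp_ofReal_mul_I]
  rw [charFun_apply_real, charFun_apply_real, integral_map hUm (by fun_prop),
    integral_map hVm (by fun_prop), ← integral_sub (hint hUm) (hint hVm)]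
  have hab : ∀ a b : ℝ, ‖Complex.exp (t * a * Complex.I) - Complex.exp (t * b * Complex.I)‖
      ≤ |t| * |a - b| := by
    intro a b
    have h1 : Complex.exp (t * a * Complex.I) - Complex.exp (t * b * Complex.I)
        = Complex.exp ((t * b : ℝ) * Complex.I)
          * (Complex.exp (Complex.I * (t * (a - b) : ℝ)) - 1) := by
      rw [mul_sub, mul_one, ← Complex.exp_add]
      congr 2 <;> push_cast <;> ring_nf
    rw [h1, norm_mul, Complex.norm_exp_ofReal_mul_I, one_mul, ← abs_mul]
    exact Real.norm_exp_I_mul_ofReal_sub_one_le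
  have hDi : Integrable (fun ω => |U ω - V ω|) P := (hD.integrable one_le_two).abs
  calc _ ≤ ∫ ω, |t| * |U ω - V ω| ∂P := by
        refine norm_integral_le_of_norm_le (hDi.const_mul _) (.of_forall fun ω => hab _ _)
    _ = |t| * ∫ ω, |U ω - V ω| ∂P := integral_const_mul _ _
    _ ≤ _ := by
        gcongr
        -- `L¹ ≤ L²`, read off from the nonnegative variance of `|U - V|`.
        refine Real.le_sqrt_of_sq_le ?_
        have := variance_nonneg (fun ω => |U ω - V ω|) P
        rw [variance_eq_sub (X := fun ω => |U ω - V ω|) hD.abs] at this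
        simpa using this

/-- Blocks of length `m + 1` separated by single terms exhaust a partial sum up to few terms. -/
lemma exists_sum_range_eq_sum_blocks (m n : ℕ) : ∃ A : Finset ℕ,
    A.card ≤ n / (m + 2) + (m + 2) ∧ ∀ w : ℕ → ℝ, ∑ k ∈ Finset.range n, w k =
      ∑ j ∈ Finset.range (n / (m + 2)), ∑ i ∈ Finset.range (m + 1), w (j * (m + 2) + i)
        + ∑ k ∈ A, w k := by
  set q := n / (m + 2) with hq
  have hqn : q * (m + 2) ≤ n := Nat.div_mul_le_self n _
  have hnq : n < q * (m + 2) + (m + 2) := by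
    have := Nat.lt_div_mul_add (a := n) (b := m + 2) (by omega)
    simpa [hq] using this
  have hinj : Function.Injective fun j : ℕ => j * (m + 2) + (m + 1) := by
    intro a b h
    have h' : a * (m + 2) = b * (m + 2) := by simpa using h
    exact Nat.eq_of_mul_eq_mul_right (by omega) h'
  have hmain : ∀ w : ℕ → ℝ, ∀ r : ℕ, ∑ k ∈ Finset.range (r * (m + 2)), w k =
      ∑ j ∈ Finset.range r, ∑ i ∈ Finset.range (m + 1), w (j * (m + 2) + i)
        + ∑ j ∈ Finset.range r, w (j * (m + 2) + (m + 1)) := by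
    intro w r
    induction r with
    | zero => simp
    | succ r ih =>
      rw [Nat.add_mul, one_mul, Finset.sum_range_add, ih, Finset.sum_range_succ _ r,
        Finset.sum_range_succ _ r, Finset.sum_range_succ _ (m + 1)]
      ring
  -- The leftover indices are the `q` separators and the incomplete last period.
  refine ⟨(Finset.range q).image (fun j => j * (m + 2) + (m + 1)) ∪ Finset.Ico (q * (m + 2)) n,
    ?_, fun w => ?_⟩
  · refine (Finset.card_union_le _ _).trans (add_le_add ?_ ?_)
    · exact Finset.card_image_le.trans (by simp)
    · rw [Nat.card_Ico]; omega
  · rw [Finset.sum_union, Finset.sum_image hinj.injOn, ← add_assoc, ← hmain,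
      Finset.sum_range_add_sum_Ico _ hqn]
    rw [Finset.disjoint_left]
    intro k hk hk'
    obtain ⟨j, hj, rfl⟩ := Finset.mem_image.1 hk
    have h1 := (Finset.mem_Ico.1 hk').1
    have h2 : (j + 1) * (m + 2) ≤ q * (m + 2) :=
      Nat.mul_le_mul_right _ (Finset.mem_range.1 hj)
    rw [Nat.add_mul] at h2
    omega

/-- Central limit theorem along the subsampled times `n / d`, normalised by `√n`. -/
lemma tendsto_charFun_sum_div [IsProbabilityMeasure P] {B : ℕ → S → ℝ} (hB : MemLp (B 0) 2 P)
    (h0 : P[B 0] = 0) (hind : iIndepFun B P) (hid : ∀ j, IdentDistrib (B j) (B 0) P P) {d : ℕ}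
    (hd : 0 < d) (t : ℝ) :
    Tendsto (fun n : ℕ =>
        charFun (P.map fun ω => (√(n : ℝ))⁻¹ * ∑ j ∈ Finset.range (n / d), B j ω) t) atTop
      (nhds (Complex.exp (-((Var[B 0; P] / d : ℝ) * t ^ 2 / 2)))) := by
  have hd' : (0 : ℝ) < d := by exact_mod_cast hd
  have hclt := tendstoInDistribution_inv_sqrt_mul_sum_sub (Y := id)
    (P' := gaussianReal 0 Var[B 0; P].toNNReal) ⟨by fun_prop, Measure.map_id⟩ hB hind hid
  have hq : Tendsto (fun n : ℕ => n / d) atTop atTop :=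
    Nat.tendsto_div_const_atTop hd.ne'
  have hclt' : TendstoInDistribution (fun (n : ℕ) ω => (√((n / d : ℕ) : ℝ))⁻¹ *
      (∑ k ∈ Finset.range (n / d), B k ω - (n / d : ℕ) * P[B 0])) atTop
      (id : ℝ → ℝ) (fun _ => P) (gaussianReal 0 Var[B 0; P].toNNReal) :=
    ⟨fun n => hclt.forall_aemeasurable _, hclt.aemeasurable_limit, hclt.tendsto.comp hq⟩
  -- Slutsky factor replacing the normalisation `√(n / d)` (floor division) by `√n`.
  have hratio : Tendsto (fun n : ℕ => √(((n / d : ℕ) : ℝ) / n)) atTop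
      (nhds (√(1 / (d : ℝ)))) := by
    refine (Real.continuous_sqrt.tendsto _).comp ?_
    have := (tendsto_nat_floor_mul_div_atTop (R := ℝ) (a := 1 / (d : ℝ)) (by positivity)).comp
      tendsto_natCast_atTop_atTop
    refine this.congr fun n => ?_
    simp only [Function.comp]
    congr 2
    rw [one_div_mul_eq_div, Nat.floor_div_natCast, Nat.floor_natCast]
  have hsl := hclt'.continuous_comp_prodMk_of_tendstoInMeasure_const
    (g := fun p : ℝ × ℝ => p.2 * p.1) (by fun_prop)
    (Y := fun n _ => √(((n / d : ℕ) : ℝ) / n)) (c := √(1 / (d : ℝ)))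
    (tendstoInMeasure_of_tendsto_ae (fun _ => by fun_prop) (.of_forall fun _ => hratio))
    (fun _ => by fun_prop)
  have hch := ProbabilityMeasure.tendsto_iff_tendsto_charFun.1 hsl.tendsto t
  simp only [ProbabilityMeasure.coe_mk, id] at hch
  rw [charFun_map_mul, charFun_gaussianReal] at hch
  convert! hch using 1
  · ext n
    congr 2
    ext ω
    rw [h0]
    rcases Nat.eq_zero_or_pos (n / d) with h | h
    · simp [h]
    · have h' : (0 : ℝ) < (n / d : ℕ) := by exact_mod_cast h
      have : √((n / d : ℕ) : ℝ) ≠ 0 := (Real.sqrt_pos.2 h').ne'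
      rw [Real.sqrt_div h'.le]
      field_simp
      simp
  · congr 2
    have hs : ((√(1 / (d : ℝ)) : ℝ) : ℂ) ^ 2 = 1 / d := by
      rw [← Complex.ofReal_pow, Real.sq_sqrt (by positivity)]; simp
    have hdc : (d : ℂ) ≠ 0 := by exact_mod_cast hd.ne'
    rw [Real.coe_toNNReal _ (variance_nonneg _ _)]
    push_cast
    rw [mul_pow, hs]
    field_simp
    simp
    ring

end OneDependent

/-! ### The one-dependent central limit theorem. -/

section OneDependentCLT

variable {S : Type*} [MeasurableSpace S] {P : Measure S} {W : ℕ → S → ℝ} {v c : ℝ}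

/-- **Central limit theorem for one-dependent sequences**: a centred, square integrable sequence
with constant variances and consecutive covariances, vanishing covariances at larger lags, and
i.i.d. sums over blocks that are separated by single terms. -/
theorem tendstoInDistribution_of_oneDependent [IsProbabilityMeasure P]
    (hL : ∀ k, MemLp (W k) 2 P) (h0 : ∀ k, P[W k] = 0) (hv : ∀ k, Var[W k; P] = v)
    (hc : ∀ k, cov[W k, W (k + 1); P] = c)
    (hz : ∀ i j, i + 1 < j → cov[W i, W j; P] = 0)
    (hind : ∀ m, iIndepFun (fun j ω => ∑ i ∈ Finset.range (m + 1), W (j * (m + 2) + i) ω) P)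
    (hid : ∀ m j, IdentDistrib (fun ω => ∑ i ∈ Finset.range (m + 1), W (j * (m + 2) + i) ω)
      (fun ω => ∑ i ∈ Finset.range (m + 1), W (0 * (m + 2) + i) ω) P P) :
    0 ≤ v + 2 * c ∧
    TendstoInDistribution (fun (n : ℕ) ω => (√(n : ℝ))⁻¹ * ∑ k ∈ Finset.range n, W k ω)
      atTop (id : ℝ → ℝ) (fun _ => P) (gaussianReal 0 (v + 2 * c).toNNReal) := by
  -- Limiting variance of the block sums: variance of one block per period `m + 2`. It equals `(v +
  -- 2 * c) - (v + 4 * c) / (m + 2)`.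
  set s : ℕ → ℝ := fun m => ((m + 1) * v + 2 * m * c) / ((m + 2 : ℕ) : ℝ) with hs
  have hvar0 : ∀ m, Var[fun ω => ∑ i ∈ Finset.range (m + 1), W (0 * (m + 2) + i) ω; P]
      = (m + 1) * v + 2 * m * c := by
    intro m
    simpa using variance_sum_range_of_oneDependent hL hv hc hz m
  have hs0 : ∀ m, 0 ≤ s m := fun m =>
    div_nonneg (hvar0 m ▸ variance_nonneg _ _) (by positivity)
  have hinv : Tendsto (fun m : ℕ => (((m + 2 : ℕ) : ℝ))⁻¹) atTop (nhds 0) :=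
    tendsto_inv_atTop_zero.comp (tendsto_natCast_atTop_atTop.comp (tendsto_add_atTop_nat 2))
  have hslim : Tendsto s atTop (nhds (v + 2 * c)) := by
    have h := (hinv.const_mul (v + 4 * c)).const_sub (v + 2 * c)
    rw [mul_zero, sub_zero] at h
    refine h.congr fun m => ?_
    have : ((m : ℝ) + 2) ≠ 0 := by positivity
    simp only [hs]
    push_cast
    field_simp
    ring
  have hpos : 0 ≤ v + 2 * c := ge_of_tendsto' hslim hs0
  have hLA : ∀ A : Finset ℕ, MemLp (fun ω => ∑ k ∈ A, W k ω) 2 P := fun A =>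
    memLp_finsetSum _ fun i _ => hL i
  refine ⟨hpos, fun n => (hLA _).aemeasurable.const_mul _, by fun_prop, ?_⟩
  refine ProbabilityMeasure.tendsto_iff_tendsto_charFun.2 fun t => ?_
  simp only [ProbabilityMeasure.coe_mk, Measure.map_id]
  rw [charFun_gaussianReal, Real.coe_toNNReal _ hpos]
  set K : ℝ := v + 2 * |c| with hK
  have hK0 : 0 ≤ K := add_nonneg (hv 0 ▸ variance_nonneg _ _) (by positivity)
  set L : ℝ → ℂ := fun x => Complex.exp (-((x : ℝ) * t ^ 2 / 2 : ℝ)) with hLdef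
  have hgoal : Complex.exp (t * (0 : ℝ) * Complex.I - (v + 2 * c : ℝ) * t ^ 2 / 2)
      = L (v + 2 * c) := by
    simp only [hLdef]; congr 1; push_cast; ring
  rw [hgoal]
  set φ : ℕ → ℂ := fun n =>
    charFun (P.map fun ω => (√(n : ℝ))⁻¹ * ∑ k ∈ Finset.range n, W k ω) t with hφ
  set ψ : ℕ → ℕ → ℂ := fun m n => charFun (P.map fun ω => (√(n : ℝ))⁻¹ *
    ∑ j ∈ Finset.range (n / (m + 2)), ∑ i ∈ Finset.range (m + 1), W (j * (m + 2) + i) ω) t with hψ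
  have hψlim : ∀ m, Tendsto (ψ m) atTop (nhds (L (s m))) := by
    intro m
    have h := tendsto_charFun_sum_div
      (B := fun j ω => ∑ i ∈ Finset.range (m + 1), W (j * (m + 2) + i) ω)
      (memLp_finsetSum _ fun i _ => hL _)
      (by rw [integral_finsetSum _ fun i _ => (hL _).integrable one_le_two]; simp [h0])
      (hind m) (hid m) (d := m + 2) (by omega) t
    rw [hvar0 m] at h
    convert! h using 3
    simp [hs]
  have hclose : ∀ m n : ℕ, 0 < n →
      ‖φ n - ψ m n‖ ≤ |t| * √(K * ((((m + 2 : ℕ) : ℝ))⁻¹ + (m + 2) * (n : ℝ)⁻¹)) := by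
    intro m n hn
    have hn' : (0 : ℝ) < n := by exact_mod_cast hn
    obtain ⟨A, hA, hsum⟩ := exists_sum_range_eq_sum_blocks m n
    have hU : MemLp (fun ω => (√(n : ℝ))⁻¹ * ∑ k ∈ Finset.range n, W k ω) 2 P :=
      (hLA _).const_mul _
    have hV : MemLp (fun ω => (√(n : ℝ))⁻¹ * ∑ j ∈ Finset.range (n / (m + 2)),
        ∑ i ∈ Finset.range (m + 1), W (j * (m + 2) + i) ω) 2 P :=
      (memLp_finsetSum _ fun j _ => memLp_finsetSum _ fun i _ => hL _).const_mul _
    refine (norm_charFun_map_sub_le hU hV t).trans ?_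
    gcongr
    have h1 : ∀ ω, ((√(n : ℝ))⁻¹ * ∑ k ∈ Finset.range n, W k ω - (√(n : ℝ))⁻¹ *
        ∑ j ∈ Finset.range (n / (m + 2)),
          ∑ i ∈ Finset.range (m + 1), W (j * (m + 2) + i) ω) ^ 2
        = (n : ℝ)⁻¹ * (∑ k ∈ A, W k ω) ^ 2 := by
      intro ω
      rw [hsum fun k => W k ω, ← mul_sub, add_sub_cancel_left, mul_pow, inv_pow,
        Real.sq_sqrt hn'.le]
    simp_rw [h1]
    rw [integral_const_mul, ← variance_of_integral_eq_zero (hLA A).aemeasurable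
      (by rw [integral_finsetSum _ fun i _ => (hL _).integrable one_le_two]; simp [h0])]
    have hcard : (A.card : ℝ) ≤ n / ((m + 2 : ℕ) : ℝ) + (m + 2) := by
      have h2 : (A.card : ℝ) ≤ ((n / (m + 2) + (m + 2) : ℕ) : ℝ) := by exact_mod_cast hA
      push_cast at h2 ⊢
      have h3 : ((n / (m + 2) : ℕ) : ℝ) ≤ n / (m + 2) := by exact_mod_cast Nat.cast_div_le
      linarith
    calc _ ≤ (n : ℝ)⁻¹ * ((n / ((m + 2 : ℕ) : ℝ) + (m + 2)) * K) := by
          gcongr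
          exact (variance_sum_le_of_oneDependent hL hv hc hz A).trans (by gcongr)
      _ = _ := by field_simp
  -- Fix `m` so that the limit in `n` of the error bound is below `δ`; only then take `n` large.
  rw [Metric.tendsto_atTop']
  intro δ hδ
  have hLc : Continuous L := by fun_prop
  have hbound : Tendsto (fun m : ℕ => |t| * √(K * (((m + 2 : ℕ) : ℝ))⁻¹)
      + dist (L (s m)) (L (v + 2 * c))) atTop (nhds 0) := by
    have h1 : Tendsto (fun m : ℕ => |t| * √(K * (((m + 2 : ℕ) : ℝ))⁻¹)) atTop (nhds 0) := by
      have := ((hinv.const_mul K).sqrt).const_mul |t|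
      simpa using this
    have h2 := tendsto_iff_dist_tendsto_zero.1 ((hLc.tendsto _).comp hslim)
    simpa using h1.add h2
  obtain ⟨m, hm⟩ := (hbound.eventually_lt_const hδ).exists
  have hlim : Tendsto (fun n : ℕ =>
      |t| * √(K * ((((m + 2 : ℕ) : ℝ))⁻¹ + (m + 2) * (n : ℝ)⁻¹))
        + dist (ψ m n) (L (v + 2 * c))) atTop
      (nhds (|t| * √(K * (((m + 2 : ℕ) : ℝ))⁻¹) + dist (L (s m)) (L (v + 2 * c)))) := by
    refine Tendsto.add (Tendsto.const_mul _ (Tendsto.sqrt (Tendsto.const_mul _ ?_)))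
      ((hψlim m).dist tendsto_const_nhds)
    have := (tendsto_inv_atTop_nhds_zero_nat (𝕜 := ℝ)).const_mul ((m : ℝ) + 2)
    simpa using this.const_add ((((m + 2 : ℕ) : ℝ))⁻¹)
  obtain ⟨N, hN⟩ := eventually_atTop.1 (hlim.eventually_lt_const hm)
  refine ⟨N, fun n hn => ?_⟩
  calc dist (φ n) (L (v + 2 * c)) ≤ dist (φ n) (ψ m n) + dist (ψ m n) (L (v + 2 * c)) :=
        dist_triangle _ _ _
    _ ≤ _ + dist (ψ m n) (L (v + 2 * c)) := by
        gcongr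
        rw [dist_eq_norm]
        exact hclose m n (by omega)
    _ < δ := hN n hn.le

end OneDependentCLT

/-! ### Functions of consecutive pairs of an i.i.d. sequence. -/

section Windows

variable {S E : Type*} [MeasurableSpace S] [MeasurableSpace E] {P : Measure S}

/-- Independence means that the joint law is a product measure, and a product over `ι × κ` regroups
as the product over `ι` of the row products. It yields independence of disjoint windows. -/
lemma iIndepFun.curry {ι κ : Type*} {Z : ι × κ → S → E} (hm : ∀ p, Measurable (Z p))
    (h : iIndepFun Z P) : iIndepFun (fun i ω (j : κ) => Z (i, j) ω) P := by
  have := h.isProbabilityMeasure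
  have : ∀ i j, IsProbabilityMeasure (P.map (Z (i, j))) :=
    fun i j => Measure.isProbabilityMeasure_map (hm _).aemeasurable
  have hs : iIndepFun (fun (p : (_ : ι) × κ) => Z (p.1, p.2)) P :=
    h.precomp (Equiv.sigmaEquivProd ι κ).injective
  have hrow : ∀ i, iIndepFun (fun j => Z (i, j)) P := fun i =>
    h.precomp (Prod.mk_right_injective i)
  rw [iIndepFun_iff_map_fun_eq_infinitePi_map (fun _ => by fun_prop)]
  have hc : (fun ω i (j : κ) => Z (i, j) ω)
      = MeasurableEquiv.piCurry (fun (_ : ι) (_ : κ) => E)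
        ∘ fun ω (p : (_ : ι) × κ) => Z (p.1, p.2) ω := by
    ext; simp [Sigma.curry]
  rw [hc, ← Measure.map_map (by fun_prop) (by fun_prop),
    (iIndepFun_iff_map_fun_eq_infinitePi_map (fun _ => by fun_prop)).1 hs,
    Measure.infinitePi_map_piCurry (fun i j => P.map (Z (i, j)))]
  congrm Measure.infinitePi fun i => ?_
  rw [(iIndepFun_iff_map_fun_eq_infinitePi_map (fun _ => by fun_prop)).1 (hrow i)]

/-- Any two tuples of distinct members of an i.i.d. sequence have the same law. -/
lemma identDistrib_tuple_of_iid {ι : Type*} [Countable ι] [IsProbabilityMeasure P]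
    {Z : ℕ → S → E} (hind : iIndepFun Z P) (hid : ∀ k, IdentDistrib (Z k) (Z 0) P P)
    {σ τ : ι → ℕ} (hσ : σ.Injective) (hτ : τ.Injective) :
    IdentDistrib (fun ω i => Z (σ i) ω) (fun ω i => Z (τ i) ω) P P :=
  IdentDistrib.pi (fun i => (hid (σ i)).trans (hid (τ i)).symm)
    (hind.precomp hσ) (hind.precomp hτ)

lemma identDistrib_pair_of_iid [IsProbabilityMeasure P]
    {Z : ℕ → S → E} (hind : iIndepFun Z P) (hid : ∀ k, IdentDistrib (Z k) (Z 0) P P)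
    {i j k l : ℕ} (hij : i ≠ j) (hkl : k ≠ l) :
    IdentDistrib (fun ω => (Z i ω, Z j ω)) (fun ω => (Z k ω, Z l ω)) P P :=
  IdentDistrib.prodMk ((hid i).trans (hid k).symm) ((hid j).trans (hid l).symm)
    (hind.indepFun hij) (hind.indepFun hkl)

lemma covariance_eq_of_identDistrib {X Y X' Y' : S → ℝ}
    (h : IdentDistrib (fun ω => (X ω, Y ω)) (fun ω => (X' ω, Y' ω)) P P) :
    cov[X, Y; P] = cov[X', Y'; P] := by
  have h1 : P[X] = P[X'] := (h.comp measurable_fst).integral_eq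
  have h2 : P[Y] = P[Y'] := (h.comp measurable_snd).integral_eq
  rw [covariance, covariance, h1, h2]
  exact (h.comp (u := fun p : ℝ × ℝ => (p.1 - P[X']) * (p.2 - P[Y'])) (by fun_prop)).integral_eq

/-- The covariance of `h(Zₐ, Z_b)` and `h(Z_a', Z_c)` depends only on the pattern of indices. -/
lemma covariance_pair_of_iid [IsProbabilityMeasure P]
    {Z : ℕ → S → E} (hind : iIndepFun Z P) (hid : ∀ k, IdentDistrib (Z k) (Z 0) P P)
    {h : E × E → ℝ} (hh : Measurable h) {σ τ : Fin 3 → ℕ} (hσ : σ.Injective) (hτ : τ.Injective)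
    (a b c d : Fin 3) :
    cov[fun ω => h (Z (σ a) ω, Z (σ b) ω), fun ω => h (Z (σ c) ω, Z (σ d) ω); P] =
      cov[fun ω => h (Z (τ a) ω, Z (τ b) ω), fun ω => h (Z (τ c) ω, Z (τ d) ω); P] :=
  covariance_eq_of_identDistrib <| (identDistrib_tuple_of_iid hind hid hσ hτ).comp
    (u := fun z : Fin 3 → E => (h (z a, z b), h (z c, z d))) (by fun_prop)

/-- **Central limit theorem for a function of consecutive pairs of an i.i.d. sequence.** -/
theorem tendstoInDistribution_sum_consecutive_pairs [IsProbabilityMeasure P]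
    {Z : ℕ → S → E} (hm : ∀ k, Measurable (Z k)) (hind : iIndepFun Z P)
    (hid : ∀ k, IdentDistrib (Z k) (Z 0) P P) {h : E × E → ℝ} (hh : Measurable h)
    (hL : MemLp (fun ω => h (Z 0 ω, Z 1 ω)) 2 P) {σ2 : ℝ}
    (hσ2 : σ2 = Var[fun ω => h (Z 0 ω, Z 1 ω); P]
      + 2 * cov[fun ω => h (Z 0 ω, Z 1 ω), fun ω => h (Z 1 ω, Z 2 ω); P]) :
    0 ≤ σ2 ∧ TendstoInDistribution (fun (n : ℕ) ω => (√(n : ℝ))⁻¹ *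
        ∑ k ∈ Finset.range n, (h (Z k ω, Z (k + 1) ω) - ∫ ω', h (Z 0 ω', Z 1 ω') ∂P))
      atTop (id : ℝ → ℝ) (fun _ => P) (gaussianReal 0 σ2.toNNReal) := by
  set θ := ∫ ω', h (Z 0 ω', Z 1 ω') ∂P with hθ
  have hidW : ∀ k, IdentDistrib (fun ω => h (Z k ω, Z (k + 1) ω)) (fun ω => h (Z 0 ω, Z 1 ω))
      P P := fun k =>
    (identDistrib_pair_of_iid hind hid (Nat.succ_ne_self k).symm zero_ne_one).comp hh
  have hLW : ∀ k, MemLp (fun ω => h (Z k ω, Z (k + 1) ω)) 2 P := fun k =>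
    (hidW k).symm.memLp_snd hL
  have hcov : ∀ i j, cov[fun ω => h (Z i ω, Z (i + 1) ω) - θ,
      fun ω => h (Z j ω, Z (j + 1) ω) - θ; P]
      = cov[fun ω => h (Z i ω, Z (i + 1) ω), fun ω => h (Z j ω, Z (j + 1) ω); P] := fun i j => by
    rw [covariance_sub_const_left ((hLW i).integrable one_le_two),
      covariance_sub_const_right ((hLW j).integrable one_le_two)]
  have hblock : ∀ m, Measurable fun z : Fin (m + 2) → E =>
      ∑ i : Fin (m + 1), (h (z i.castSucc, z i.succ) - θ) := fun m => by fun_prop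
  have hsum : ∀ m j ω, ∑ i ∈ Finset.range (m + 1),
      (h (Z (j * (m + 2) + i) ω, Z (j * (m + 2) + i + 1) ω) - θ)
      = ∑ i : Fin (m + 1), (h (Z (j * (m + 2) + i.castSucc) ω, Z (j * (m + 2) + i.succ) ω) - θ) :=
    fun m j ω => by
      rw [Finset.sum_range]
      simp [add_assoc]
  -- A block of `m + 1` pairs reads `m + 2` variables, exactly one period, so distinct blocks read
  -- disjoint windows.
  have hinj : ∀ m, Function.Injective fun p : ℕ × Fin (m + 2) => p.1 * (m + 2) + (p.2 : ℕ) := by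
    intro m ⟨a, i⟩ ⟨b, j⟩ hab
    have hab' : a * (m + 2) + (i : ℕ) = b * (m + 2) + (j : ℕ) := hab
    have h1 : a = b := by
      have := congrArg (· / (m + 2)) hab'
      simpa [Nat.add_div_of_dvd_right, Nat.div_eq_of_lt] using this
    subst h1
    simpa [Fin.ext_iff] using hab'
  rw [hσ2]
  refine tendstoInDistribution_of_oneDependent (W := fun k ω => h (Z k ω, Z (k + 1) ω) - θ)
    (fun k => (hLW k).sub (memLp_const θ)) (fun k => ?_) (fun k => ?_) (fun k => ?_)
    (fun i j hij => ?_) (fun m => ?_) (fun m j => ?_)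
  · rw [integral_sub ((hLW k).integrable one_le_two) (integrable_const _), (hidW k).integral_eq]
    simp [hθ]
  · rw [variance_sub_const (hLW k).aestronglyMeasurable, (hidW k).variance_eq]
  · rw [hcov]
    have := covariance_pair_of_iid hind hid hh (σ := fun i => k + i) (τ := fun i => i)
      (fun a b hab => by simpa [Fin.ext_iff] using hab) Fin.val_injective 0 1 1 2
    simpa using this
  · rw [hcov]
    refine IndepFun.covariance_eq_zero ?_ (hLW i) (hLW j)
    exact (hind.indepFun_prodMk_prodMk hm i (i + 1) j (j + 1) (by omega) (by omega) (by omega)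
      (by omega)).comp hh hh
  · simp only [hsum]
    exact (iIndepFun.curry (fun p => hm _) (hind.precomp (hinj m))).comp _ fun _ => hblock m
  · simp only [hsum]
    exact (identDistrib_tuple_of_iid hind hid (ι := Fin (m + 2))
      (σ := fun i => j * (m + 2) + (i : ℕ)) (τ := fun i => 0 * (m + 2) + (i : ℕ))
      (fun a b hab => by simpa [Fin.ext_iff] using hab)
      (fun a b hab => by simpa [Fin.ext_iff] using hab)).comp (hblock m)

end Windows

/-! ### The autoregressive model under the null hypothesis. -/

section Null

lemma covariance_congr_ae {S : Type*} [MeasurableSpace S] {P : Measure S} {X Y X' Y' : S → ℝ}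
    (hX : X =ᵐ[P] X') (hY : Y =ᵐ[P] Y') : cov[X, Y; P] = cov[X', Y'; P] := by
  rw [covariance, covariance, integral_congr_ae hX, integral_congr_ae hY]
  refine integral_congr_ae ?_
  filter_upwards [hX, hY] with ω h1 h2
  rw [h1, h2]

variable {S Ω : Type*} [MeasurableSpace S] [MetricSpace Ω] [MeasurableSpace Ω]
  {P : Measure S} {ε : ℕ → S → Ω → Ω} {X : ℕ → S → Ω} {μ : Ω}

/-- With concentration parameter `0`, the model reads `X (t+1) = ε (t+1) μ`. -/
lemma IsGAR1.ae_eq_noise (hX : IsGAR1 P ε X μ 0) (t : ℕ) :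
    (fun s => ε (t + 1) s μ) =ᵐ[P] X (t + 1) := by
  filter_upwards [hX.recursion t] with s ⟨γ, hγ, h⟩
  rw [h, hγ.source]

lemma IsGAR1.iIndepFun_succ (hX : IsGAR1 P ε X μ 0) : iIndepFun (fun t => X (t + 1)) P := by
  have h : iIndepFun (fun t s => ε (t + 1) s μ) P :=
    (hX.noise.indep.precomp (add_left_injective 1)).comp (fun _ f => f μ)
      fun _ => measurable_pi_apply μ
  exact h.congr hX.ae_eq_noise

lemma IsGAR1.identDistrib_noise (hX : IsGAR1 P ε X μ 0) (t r : ℕ) :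
    IdentDistrib (X (t + 1)) (fun s => ε r s μ) P P :=
  (IdentDistrib.of_ae_eq (hX.inL1 _).measurable.aemeasurable (hX.ae_eq_noise t).symm).trans <|
    ((hX.noise.identDistrib (t + 1)).trans (hX.noise.identDistrib r).symm).comp
      (measurable_pi_apply μ)

end Null

/-- `hdist` holds automatically when `Ω` is separable; it makes `d(X₁, X₂)` a random variable
determined by the pair `(X₁, X₂)`. `hvar` says that `d(X₁, X₂)²` has finite variance. -/
theorem mainTheorem3 {S Ω : Type*} [MeasurableSpace S] [MetricSpace Ω] [MeasurableSpace Ω]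
    [BorelSpace Ω] (hΩ : IsHadamard Ω) (P : Measure S) [IsProbabilityMeasure P]
    (ε : ℕ → S → Ω → Ω) (X : ℕ → S → Ω) (μ : Ω) (φ : unitInterval)
    (hX : IsGAR1 P ε X μ φ)
    (hH0 : φ = 0)
    (hdist : AEMeasurable (fun p : Ω × Ω => dist p.1 p.2) (P.map (fun s => (X 1 s, X 2 s))))
    (hvar : MemLp (fun s => dist (X 1 s) (X 2 s) ^ 2) 2 P) :
    (iIndepFun (fun t : ℕ => X (t + 1)) P ∧
      ∀ t r : ℕ, IdentDistrib (X (t + 1)) (fun s => ε r s μ) P P) ∧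
    0 ≤ nullVariance P X ∧
    TendstoInDistribution
      (fun (T : ℕ) (s : S) =>
        √(T : ℝ) * (serialStat X T s - ∫ s', dist (X 1 s') (X 2 s') ^ 2 ∂P))
      atTop (id : ℝ → ℝ) (fun _ => P) (gaussianReal 0 (nullVariance P X).toNNReal) := by
  subst hH0
  refine ⟨⟨hX.iIndepFun_succ, hX.identDistrib_noise⟩, ?_⟩
  set Z : ℕ → S → Ω := fun t => X (t + 1) with hZ
  have hm : ∀ k, Measurable (Z k) := fun k => (hX.inL1 _).measurable
  have hind : iIndepFun Z P := hX.iIndepFun_succ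
  have hid : ∀ k, IdentDistrib (Z k) (Z 0) P P := fun k =>
    (hX.identDistrib_noise k 0).trans (hX.identDistrib_noise 0 0).symm
  -- `u` is a measurable version of the distance for the law of `(X 1, X 2)`, which is the law of
  -- every pair of distinct `Z i, Z j`.
  obtain ⟨u, hu, hdu⟩ := hdist
  set h : Ω × Ω → ℝ := fun p => u p ^ 2
  have hhm : Measurable h := hu.pow_const 2
  have hae : ∀ i j, i ≠ j →
      (fun s => dist (Z i s) (Z j s) ^ 2) =ᵐ[P] fun s => h (Z i s, Z j s) := by
    intro i j hij
    have hlaw : P.map (fun s => (X 1 s, X 2 s)) = P.map (fun s => (Z i s, Z j s)) :=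
      (identDistrib_pair_of_iid hind hid (i := 0) (j := 1) zero_ne_one hij).map_eq
    rw [hlaw] at hdu
    filter_upwards [ae_of_ae_map ((hm i).prodMk (hm j)).aemeasurable hdu] with s hs
    exact congrArg (· ^ 2) hs
  have hL : MemLp (fun s => h (Z 0 s, Z 1 s)) 2 P := hvar.ae_eq (hae 0 1 zero_ne_one)
  have hθ : ∫ s', dist (X 1 s') (X 2 s') ^ 2 ∂P = ∫ s', h (Z 0 s', Z 1 s') ∂P :=
    integral_congr_ae (hae 0 1 zero_ne_one)
  have hnull : nullVariance P X = Var[fun s => h (Z 0 s, Z 1 s); P]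
      + 2 * cov[fun s => h (Z 0 s, Z 1 s), fun s => h (Z 1 s, Z 2 s); P] := by
    -- Exchanging indices 0 and 1 turns the pairs `01, 02` of `nullVariance` into `10, 12`; symmetry
    -- of the distance, inherited by `h` only a.s., gives the chain `01, 12`.
    have hflip : (fun s => h (Z 1 s, Z 0 s)) =ᵐ[P] fun s => h (Z 0 s, Z 1 s) := by
      filter_upwards [hae 0 1 zero_ne_one, hae 1 0 one_ne_zero] with s h1 h2
      rw [← h1, ← h2, dist_comm]
    have hperm := covariance_pair_of_iid hind hid hhm (σ := ![0, 1, 2]) (τ := ![1, 0, 2])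
      (by decide) (by decide) 0 1 0 2
    rw [nullVariance, variance_congr (hae 0 1 zero_ne_one),
      covariance_congr_ae (hae 0 1 zero_ne_one) (hae 0 2 (by decide))]
    congr 2
    exact hperm.trans (covariance_congr_ae hflip .rfl)
  obtain ⟨hpos, hclt⟩ := tendstoInDistribution_sum_consecutive_pairs hm hind hid hhm hL hnull
  refine ⟨hpos, ?_⟩
  rw [hθ]
  set θ := ∫ s', h (Z 0 s', Z 1 s') ∂P
  have hpred : TendstoInDistribution (fun (T : ℕ) s => (√((T - 1 : ℕ) : ℝ))⁻¹ *
      ∑ k ∈ Finset.range (T - 1), (h (Z k s, Z (k + 1) s) - θ)) atTop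
      (id : ℝ → ℝ) (fun _ => P) (gaussianReal 0 (nullVariance P X).toNNReal) :=
    ⟨fun T => hclt.forall_aemeasurable _, hclt.aemeasurable_limit,
      hclt.tendsto.comp (tendsto_sub_atTop_nat 1)⟩
  -- Slutsky factor from `√(T - 1)` to `√T`. At `T = 1` the statistic is 0 by convention, and the
  -- offset `-θ` makes the identity exact there too.
  have hcoef : Tendsto (fun T : ℕ => (√((T : ℝ) / (T - 1 : ℕ)), if T = 1 then -θ else 0)) atTop
      (nhds ((1 : ℝ), (0 : ℝ))) := by
    refine Tendsto.prodMk_nhds ?_ (tendsto_const_nhds.congr' ?_)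
    · rw [← Real.sqrt_one]
      refine ((tendsto_add_atTop_iff_nat 1).1 ?_).sqrt
      have := (tendsto_natCast_div_add_atTop (𝕜 := ℝ) 1).inv₀ one_ne_zero
      rw [inv_one] at this
      exact this.congr fun n => by simp
    · filter_upwards [eventually_gt_atTop 1] with T hT
      rw [if_neg (by omega)]
  have hsl := hpred.continuous_comp_prodMk_of_tendstoInMeasure_const
    (g := fun p : ℝ × ℝ × ℝ => p.2.1 * p.1 + p.2.2) (by fun_prop)
    (Y := fun (T : ℕ) _ => (√((T : ℝ) / (T - 1 : ℕ)), if T = 1 then -θ else 0)) (c := (1, 0))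
    (tendstoInMeasure_of_tendsto_ae (fun _ => by fun_prop) (.of_forall fun _ => hcoef))
    (fun _ => by fun_prop)
  refine hsl.congr (fun T => ?_) (.of_forall fun x => by simp)
  have hall : ∀ᵐ s ∂P, ∀ k, dist (Z k s) (Z (k + 1) s) ^ 2 = h (Z k s, Z (k + 1) s) :=
    ae_all_iff.2 fun k => hae k (k + 1) (by omega)
  filter_upwards [hall] with s hs
  rcases T with _ | _ | n
  · simp
  · simp [serialStat]
  · have hn : (0 : ℝ) < n + 1 := by positivity
    have hsum : ∑ t ∈ Finset.Ico 1 (n + 1 + 1), dist (X t s) (X (t + 1) s) ^ 2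
        = ∑ k ∈ Finset.range (n + 1), h (Z k s, Z (k + 1) s) := by
      rw [Finset.sum_Ico_eq_sum_range]
      refine Finset.sum_congr (by simp) fun k _ => ?_
      rw [← hs k, add_comm 1 k]
    rw [serialStat, hsum, Finset.sum_sub_distrib, if_neg (by omega)]
    simp only [Finset.sum_const, Finset.card_range, nsmul_eq_mul, Nat.add_sub_cancel]
    push_cast
    rw [Real.sqrt_div (by positivity), add_sub_cancel_right]
    have hsq : √((n : ℝ) + 1) * √((n : ℝ) + 1) = n + 1 := Real.mul_self_sqrt hn.le
    have hsq0 : √((n : ℝ) + 1) ≠ 0 := (Real.sqrt_pos.2 hn).ne'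
    generalize √((n : ℝ) + 1) = r at hsq hsq0
    rw [← hsq]
    field_simp
    ring
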